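/- Let $0<q<1$, $\gamma>-1$ and let $c\ge 0$ be an integer. Write $(a;q)_k=\prod_{i=0}^{k-1}(1-aq^i)$, $(a;q)_\infty=\prod_{i\ge0}(1-aq^i)$, $[a]_q=\frac{q^a-1}{q-1}$, and $${}_m\phi_p\left[{a_1,\dots,a_m\atop b_1,\dots,b_p};q;z\right]=\sum_{k\ge0}\frac{(a_1;q)_k\cdots(a_m;q)_k}{(q;q)_k(b_1;q)_k\cdots(b_p;q)_k}\left[(-1)^kq^{k(k-1)/2}\right]^{1+p-m}z^k .$$ Let $\mathcal D_q h(x)=\frac{h(qx)-h(x)}{(q-1)x}$ for $x\ne0$ and $\mathcal D_qh(0)=h'(0)$, with iterates $\mathcal D_q^j$. For $n=0,1,2,\dots$ let $$\mathcal L_n^{(\gamma)}(z;q)={}_1\phi_1\left[{q^{-n}\atop q^{\gamma+1}};q;-q^{n+\gamma+1}z\right],\qquad \mathfrak L_n^{(\gamma)}(z,c;q)={}_2\phi_2\left[{q^{-n},\,q\atop q^{\gamma+1},\,q^{c+1}};q;-q^{n+\gamma+1}z\right]$$ be the $q$-Laguerre polynomials (normalized to be $1$ at $z=0$) and the generalized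 $q$-Laguerre polynomials; write $y_n(z)=\mathfrak L_n^{(\gamma)}(z,c;q)$. Put $$\mathfrak D_q^c=\sum_{j=0}^c d_j(z;q)\,\mathcal D_q^j,\qquad d_j(z;q)=\left(\frac{(q;q)_c}{(q;q)_j}\right)^2\frac{q^{j^2}}{(q;q)_{c-j}(1-q)^{c-j}}\,z^j .$$ Then the following hold. 1. Each $y_n$ is a polynomial of degree $n$, and for all $n$ and all real $z$, $$\mathfrak D_q^c y_n(z)=\mathcal D_q^c\big(z^c y_n(z)\big)=\frac{(q;q)_c}{(1-q)^c}\,\mathcal L_n^{(\gamma)}(z;q).$$ 2. For all $n,m\ge0$ the integral below converges absolutely and $$\int_0^\infty \mathfrak D_q^c y_n(z)\;\mathfrak D_q^c y_m(z)\;\frac{z^\gamma}{(-z;q)_\infty}\,dz=A_{n,q}\,\delta_{mn},$$ $$A_{n,q}=\frac{(q;q)_n}{(q^{\gamma+1};q)_n\,q^n}\;\frac{(q^{-\gamma};q)_\infty}{(q;q)_\infty}\left(\frac{(q;q)_c}{(1-q)^c}\right)^2\Gamma(-\gamma)\,\Gamma(\gamma+1)>0 .$$ When $\gamma\in\{0,1,2,\dots\}$,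 the product $(q^{-\gamma};q)_\infty\Gamma(-\gamma)\Gamma(\gamma+1)$ is understood as its limit at $\gamma$, which exists. 3. For all $n$ and all real $z$, the function $u=\mathfrak D_q^c y_n$ satisfies $$(qz^2+z)\,\mathcal D_q^2u(z)+\left(\frac{q}{q-1}z+\frac{[\gamma+1]_q}{q^{\gamma+1}}\right)\mathcal D_qu(z)=\frac{[n]_q}{q-1}\,u(qz).$$ -/

import Mathlib

open Filter Topology MeasureTheory

noncomputable section

/-- The `q`-shifted factorial `(a;q)_k = (1 - a)(1 - a q) ⋯ (1 - a q^(k-1))`. -/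
def qPoch (a q : ℝ) (k : ℕ) : ℝ := ∏ i ∈ Finset.range k, (1 - a * q ^ i)

/-- The infinite product `(a;q)_∞`. -/
def qPochInf (a q : ℝ) : ℝ := ∏' i : ℕ, (1 - a * q ^ i)

/-- The `q`-number `[a]_q` for a real `a`. -/
def qNumber (q a : ℝ) : ℝ := (q ^ a - 1) / (q - 1)

/-- The basic hypergeometric series `_mφ_p` with upper parameters `as` (of length `m`), lower
parameters `bs` (of length `p`), base `q` and argument `z`. -/
def basicHypergeometric (as bs : List ℝ) (q z : ℝ) : ℝ :=
  ∑' k : ℕ, (as.map fun a => qPoch a q k).prod /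
      (qPoch q q k * (bs.map fun b => qPoch b q k).prod) *
    ((-1) ^ k * q ^ (k.choose 2)) ^ (1 + (bs.length : ℤ) - (as.length : ℤ)) * z ^ k

/-- The `q`-Laguerre polynomial `₁φ₁(q^(-n); q^(γ+1); q; -q^(n+γ+1) z)`, normalized to have
the value `1` at `z = 0`. -/
def qLaguerre (q γ : ℝ) (n : ℕ) (z : ℝ) : ℝ :=
  basicHypergeometric [q ^ (-(n : ℤ))] [q ^ (γ + 1)] q (-q ^ ((n : ℝ) + γ + 1) * z)

/-- The generalized `q`-Laguerre polynomial
`₂φ₂(q^(-n), q; q^(γ+1), q^(c+1); q; -q^(n+γ+1) z)`. -/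
def genQLaguerre (q γ c : ℝ) (n : ℕ) (z : ℝ) : ℝ :=
  basicHypergeometric [q ^ (-(n : ℤ)), q] [q ^ (γ + 1), q ^ (c + 1)] q
    (-q ^ ((n : ℝ) + γ + 1) * z)

/-- The `q`-difference operator. Its powers are the iterates `(qDeriv q)^[j]`. -/
def qDeriv (q : ℝ) (h : ℝ → ℝ) (x : ℝ) : ℝ :=
  if x = 0 then deriv h 0 else (h (q * x) - h x) / ((q - 1) * x)

/-- The coefficient `d_j(z;q)`, `0 ≤ j ≤ c`, of the Sobolev operator. -/
def sobolevCoeff (q : ℝ) (c j : ℕ) (z : ℝ) : ℝ :=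
  (qPoch q q c / qPoch q q j) ^ 2 *
    (q ^ (j ^ 2) / (qPoch q q (c - j) * (1 - q) ^ (c - j))) * z ^ j

/-- The Sobolev operator `∑_{j=0}^{c} d_j(z;q) D_q^j`. -/
def sobolevOp (q : ℝ) (c : ℕ) (y : ℝ → ℝ) (z : ℝ) : ℝ :=
  ∑ j ∈ Finset.range (c + 1), sobolevCoeff q c j z * (qDeriv q)^[j] y z

/-- The second-order `q`-difference operator `l₂ D_q^2 + l₁ D_q + l₀` of the `q`-Laguerre
polynomials, where `l₀ = 0`. -/
def qLaguerreOp (q γ : ℝ) (u : ℝ → ℝ) (z : ℝ) : ℝ :=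
  (q * z ^ 2 + z) * (qDeriv q)^[2] u z +
    (q / (q - 1) * z + qNumber q (γ + 1) / q ^ (γ + 1)) * qDeriv q u z

/-- The weight `z^γ / (-z;q)_∞`. -/
def qLaguerreWeight (q γ z : ℝ) : ℝ := z ^ γ / qPochInf (-z) q

/-- The product `(q^(-g);q)_∞ Γ(-g) Γ(g+1)`. It is meaningful for `g ≠ 0, 1, 2, …`; at these
points it has a removable singularity. -/
def gammaProduct (q g : ℝ) : ℝ :=
  qPochInf (q ^ (-g)) q * Real.Gamma (-g) * Real.Gamma (g + 1)

/-- The squared norm of the `n`-th polynomial; `κ` stands for the value at `γ` of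
`(q^(-γ);q)_∞ Γ(-γ) Γ(γ+1)`. -/
def sobolevNorm (q γ κ : ℝ) (c n : ℕ) : ℝ :=
  qPoch q q n / (qPoch (q ^ (γ + 1)) q n * q ^ n) * (κ / qPochInf q q) *
    (qPoch q q c / (1 - q) ^ c) ^ 2

end

/-! On monomials, `x ↦ D_q^c (x^c · x^k)` only multiplies `x^k` by `(q;q)_{k+c} / ((q;q)_k
(1-q)^c)`. The coefficients of `y_n` differ from those of the `q`-Laguerre polynomial by `(q;q)_k /
(q^(c+1);q)_k`, and the product of the two factors does not depend on `k` (`qFall_mul_qPoch_div`).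
The Sobolev operator acts on monomials in the same way, by a `q`-Vandermonde identity
(`qFall_add_eq_sum`). Everything is thereby reduced to the `q`-Laguerre polynomials themselves.

Their difference equation is a two-term recurrence for coefficients. Their orthogonality rests on
the moments `qMoment`: the substitution `x ↦ q x` gives `M(s+1) = (q^(-s) - 1) M(s)`, so moments at
`s + k` are multiples of `(q^s;q)_k`, and the finite `q`-binomial theorem evaluates the resulting
sums (`sum_qPochCoeff_mul_qPoch`).

The norm needs `M(γ+1)`, which is Ramanujan's integral. For exponents in `(0,1)` it is the limit of
integrals over finite products, starting from Euler's integral. The functional equation shared with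
`gammaProduct` extends it to larger non-integral `γ`, and continuity of `M` removes the
singularities at the integers. -/

noncomputable section

/-! ### Finite `q`-shifted factorials and the `q`-binomial theorem -/

theorem one_sub_pow_pos {q : ℝ} (hq0 : 0 < q) (hq1 : q < 1) (k : ℕ) : 0 < 1 - q ^ (k + 1) :=
  sub_pos.2 (pow_lt_one₀ hq0.le hq1 k.succ_ne_zero)

theorem qPoch_zero (a q : ℝ) : qPoch a q 0 = 1 := by simp [qPoch]

theorem qPoch_succ (a q : ℝ) (k : ℕ) : qPoch a q (k + 1) = qPoch a q k * (1 - a * q ^ k) := by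
  simp [qPoch, Finset.prod_range_succ]

theorem qPoch_succ' (a q : ℝ) (k : ℕ) :
    qPoch a q (k + 1) = (1 - a) * qPoch (a * q) q k := by
  simp only [qPoch, Finset.prod_range_succ', pow_zero, mul_one]
  rw [mul_comm]
  congr 1
  exact Finset.prod_congr rfl fun i _ => by ring

theorem qPoch_add (a q : ℝ) (k l : ℕ) :
    qPoch a q (k + l) = qPoch a q k * qPoch (a * q ^ k) q l := by
  simp only [qPoch, Finset.prod_range_add]
  congr 1
  exact Finset.prod_congr rfl fun i _ => by ring

theorem qPoch_pos {a q : ℝ} (hq0 : 0 < q) (hq1 : q < 1) (ha : a < 1) (k : ℕ) :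
    0 < qPoch a q k := by
  refine Finset.prod_pos fun i _ => ?_
  have h1 : 0 < q ^ i := pow_pos hq0 i
  have h2 : q ^ i ≤ 1 := pow_le_one₀ hq0.le hq1.le
  nlinarith

/-- The product `∏_{i<k} (q^n - q^i) / (1 - q^(i+1))`, the coefficient of `w^k` in `(w;q)_n`. -/
def qPochCoeff (q : ℝ) (n k : ℕ) : ℝ :=
  ∏ i ∈ Finset.range k, (q ^ n - q ^ i) / (1 - q ^ (i + 1))

theorem qPochCoeff_succ (q : ℝ) (n k : ℕ) :
    qPochCoeff q n (k + 1) = qPochCoeff q n k * ((q ^ n - q ^ k) / (1 - q ^ (k + 1))) := by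
  rw [qPochCoeff, Finset.prod_range_succ, ← qPochCoeff]

theorem qPochCoeff_eq_zero {n k : ℕ} (q : ℝ) (h : n < k) : qPochCoeff q n k = 0 :=
  Finset.prod_eq_zero (Finset.mem_range.2 h) (by simp)

theorem qPochCoeff_ne_zero {q : ℝ} (hq0 : 0 < q) (hq1 : q < 1) {n k : ℕ} (h : k ≤ n) :
    qPochCoeff q n k ≠ 0 := by
  refine Finset.prod_ne_zero_iff.2 fun i hi => div_ne_zero ?_ (one_sub_pow_pos hq0 hq1 i).ne'
  exact (sub_neg.2 (pow_lt_pow_right_of_lt_one₀ hq0 hq1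
    ((Finset.mem_range.1 hi).trans_le h))).ne

theorem qPochCoeff_eq {q : ℝ} (hq0 : 0 < q) (n k : ℕ) :
    qPochCoeff q n k = qPoch (q ^ (-(n : ℤ))) q k / qPoch q q k * (q ^ n) ^ k := by
  rw [qPochCoeff, Finset.prod_div_distrib, qPoch, qPoch, div_mul_eq_mul_div]
  congr 1
  · rw [← Finset.card_range k, ← Finset.prod_const, Finset.card_range, ← Finset.prod_mul_distrib]
    refine Finset.prod_congr rfl fun i _ => ?_
    rw [zpow_neg, zpow_natCast]
    field_simp
  · exact Finset.prod_congr rfl fun i _ => by ring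

theorem qPochCoeff_succ_succ {q : ℝ} (hq0 : 0 < q) (hq1 : q < 1) (n k : ℕ) :
    qPochCoeff q (n + 1) (k + 1) = qPochCoeff q n (k + 1) - q ^ n * qPochCoeff q n k := by
  have h1 := (one_sub_pow_pos hq0 hq1 k).ne'
  -- Since `q^(n+1) - q^(i+1) = q (q^n - q^i)`, all three terms are multiples of `qPochCoeff q n k`.
  have key : qPochCoeff q (n + 1) (k + 1) =
      qPochCoeff q n k * (q ^ k * (q ^ (n + 1) - 1) / (1 - q ^ (k + 1))) := by
    simp only [qPochCoeff, Finset.prod_div_distrib]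
    rw [Finset.prod_range_succ', Finset.prod_range_succ (fun i => 1 - q ^ (i + 1))]
    have : ∏ i ∈ Finset.range k, (q ^ (n + 1) - q ^ (i + 1)) =
        q ^ k * ∏ i ∈ Finset.range k, (q ^ n - q ^ i) := by
      rw [← Finset.card_range k, ← Finset.prod_const, Finset.card_range,
        ← Finset.prod_mul_distrib]
      exact Finset.prod_congr rfl fun i _ => by ring
    rw [this, pow_zero]
    have h2 : ∏ i ∈ Finset.range k, (1 - q ^ (i + 1)) ≠ 0 :=
      Finset.prod_ne_zero_iff.2 fun i _ => (one_sub_pow_pos hq0 hq1 i).ne'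
    field_simp
  rw [key, qPochCoeff_succ]
  field_simp
  ring

/-- The finite `q`-binomial theorem. -/
theorem sum_qPochCoeff_mul_pow {q : ℝ} (hq0 : 0 < q) (hq1 : q < 1) (n : ℕ) (w : ℝ) :
    ∑ k ∈ Finset.range (n + 1), qPochCoeff q n k * w ^ k = qPoch w q n := by
  induction n with
  | zero => simp [qPochCoeff, qPoch]
  | succ n ih =>
    rw [Finset.sum_range_succ']
    simp only [qPochCoeff_succ_succ hq0 hq1]
    have h0 : qPochCoeff q (n + 1) 0 = qPochCoeff q n 0 := by simp [qPochCoeff]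
    rw [h0, qPoch_succ, ← ih, Finset.sum_congr rfl fun k _ => sub_mul _ _ (w ^ (k + 1)),
      Finset.sum_sub_distrib, sub_add_eq_add_sub,
      ← Finset.sum_range_succ' (fun k => qPochCoeff q n k * w ^ k), Finset.sum_range_succ,
      qPochCoeff_eq_zero q n.lt_succ_self, mul_sub, mul_one, Finset.sum_mul]
    simp only [zero_mul, add_zero]
    refine congrArg _ (Finset.sum_congr rfl fun k _ => ?_)
    rw [pow_succ]
    ring

/-- The factors on the left are `1 - q^(-m)` with `1 ≤ m ≤ n`; multiplying each by `q^m` turns it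
into `-(1 - q^m)`. -/
theorem qPoch_neg_pow_eq {q : ℝ} (hq0 : 0 < q) (n : ℕ) :
    qPoch ((q ^ n)⁻¹) q n * q ^ ((n + 1).choose 2) = (-1) ^ n * qPoch q q n := by
  induction n with
  | zero => simp [qPoch]
  | succ n ih =>
    have h : (q ^ (n + 1))⁻¹ * q = (q ^ n)⁻¹ := by
      rw [pow_succ]
      field_simp
    rw [qPoch_succ', h, qPoch_succ, pow_succ (-1 : ℝ), Nat.choose_succ_succ' (n + 1) 1,
      Nat.choose_one_right, pow_add]
    have : (1 - (q ^ (n + 1))⁻¹) * q ^ (n + 1) = -(1 - q * q ^ n) := by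
      field_simp
      ring
    linear_combination (-(1 - q * q ^ n)) * ih +
      qPoch ((q ^ n)⁻¹) q n * q ^ ((n + 1).choose 2) * this

/-! ### The terminating series as finite sums -/

/-- The coefficients of the `q`-Laguerre polynomials, with `b` in place of `q^(γ+1)`. -/
def qLaguerreCoeff (q b : ℝ) (n k : ℕ) : ℝ :=
  qPochCoeff q n k * q ^ (k.choose 2) * b ^ k / qPoch b q k

theorem qLaguerreCoeff_eq_zero {n k : ℕ} (q b : ℝ) (h : n < k) : qLaguerreCoeff q b n k = 0 := by
  simp [qLaguerreCoeff, qPochCoeff_eq_zero q h]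

theorem qLaguerreCoeff_ne_zero {q b : ℝ} (hq0 : 0 < q) (hq1 : q < 1) (hb0 : 0 < b) (hb1 : b < 1)
    {n k : ℕ} (h : k ≤ n) : qLaguerreCoeff q b n k ≠ 0 := by
  have := qPochCoeff_ne_zero hq0 hq1 h
  have := (qPoch_pos hq0 hq1 hb1 k).ne'
  unfold qLaguerreCoeff
  positivity

theorem qLaguerre_eq_sum {q : ℝ} (hq0 : 0 < q) (γ : ℝ) (n : ℕ) (z : ℝ) :
    qLaguerre q γ n z =
      ∑ k ∈ Finset.range (n + 1), qLaguerreCoeff q (q ^ (γ + 1)) n k * z ^ k := by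
  have key : ∀ k : ℕ, (List.map (fun a => qPoch a q k) [q ^ (-(n : ℤ))]).prod /
      (qPoch q q k * (List.map (fun b => qPoch b q k) [q ^ (γ + 1)]).prod) *
      ((-1) ^ k * q ^ (k.choose 2)) ^ (1 + (([q ^ (γ + 1)] : List ℝ).length : ℤ) -
        (([q ^ (-(n : ℤ))] : List ℝ).length : ℤ)) * (-q ^ ((n : ℝ) + γ + 1) * z) ^ k =
      qLaguerreCoeff q (q ^ (γ + 1)) n k * z ^ k := by
    intro k
    rw [add_assoc (n : ℝ), Real.rpow_add hq0 (n : ℝ), Real.rpow_natCast, qLaguerreCoeff, qPochCoeff_eq hq0]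
    simp only [List.map_cons, List.map_nil, List.prod_cons, List.prod_nil, List.length_cons,
      List.length_nil, mul_one]
    norm_num
    rw [neg_pow (_ * z), mul_pow, mul_pow]
    -- One sign belongs to the series, the other to its negative argument.
    have h1 : ((-1 : ℝ) ^ k) * (-1) ^ k = 1 := by rw [← mul_pow]; norm_num
    linear_combination (qPoch ((q ^ n)⁻¹) q k / (qPoch q q k * qPoch (q ^ (γ + 1)) q k) *
      q ^ (k.choose 2) * (q ^ n) ^ k * (q ^ (γ + 1)) ^ k * z ^ k) * h1
  rw [qLaguerre, basicHypergeometric]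
  simp only [key]
  exact tsum_eq_sum fun k hk => by
    rw [qLaguerreCoeff_eq_zero _ _ (by simpa [Nat.lt_succ_iff] using hk), zero_mul]

theorem genQLaguerre_eq_sum {q : ℝ} (hq0 : 0 < q) (γ : ℝ) (c n : ℕ) (z : ℝ) :
    genQLaguerre q γ c n z =
      ∑ k ∈ Finset.range (n + 1), (qLaguerreCoeff q (q ^ (γ + 1)) n k *
        (qPoch q q k / qPoch (q ^ (c + 1)) q k)) * z ^ k := by
  have key : ∀ k : ℕ, (List.map (fun a => qPoch a q k) [q ^ (-(n : ℤ)), q]).prod /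
      (qPoch q q k * (List.map (fun b => qPoch b q k) [q ^ (γ + 1), q ^ ((c : ℝ) + 1)]).prod) *
      ((-1) ^ k * q ^ (k.choose 2)) ^ (1 + (([q ^ (γ + 1), q ^ ((c : ℝ) + 1)] : List ℝ).length : ℤ)
        - (([q ^ (-(n : ℤ)), q] : List ℝ).length : ℤ)) * (-q ^ ((n : ℝ) + γ + 1) * z) ^ k =
      (qLaguerreCoeff q (q ^ (γ + 1)) n k *
        (qPoch q q k / qPoch (q ^ (c + 1)) q k)) * z ^ k := by
    intro k
    have hc : q ^ ((c : ℝ) + 1) = q ^ (c + 1) := by exact_mod_cast Real.rpow_natCast q (c + 1)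
    rw [add_assoc (n : ℝ), Real.rpow_add hq0 (n : ℝ), Real.rpow_natCast, qLaguerreCoeff,
      qPochCoeff_eq hq0, hc]
    simp only [List.map_cons, List.map_nil, List.prod_cons, List.prod_nil, List.length_cons,
      List.length_nil, mul_one]
    norm_num
    rw [neg_pow (_ * z), mul_pow, mul_pow]
    have h1 : ((-1 : ℝ) ^ k) * (-1) ^ k = 1 := by rw [← mul_pow]; norm_num
    linear_combination (qPoch ((q ^ n)⁻¹) q k * qPoch q q k /
      (qPoch q q k * (qPoch (q ^ (γ + 1)) q k * qPoch (q ^ (c + 1)) q k)) *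
      q ^ (k.choose 2) * (q ^ n) ^ k * (q ^ (γ + 1)) ^ k * z ^ k) * h1
  rw [genQLaguerre, basicHypergeometric]
  simp only [key]
  exact tsum_eq_sum fun k hk => by
    rw [qLaguerreCoeff_eq_zero _ _ (by simpa [Nat.lt_succ_iff] using hk), zero_mul, zero_mul]

/-! ### `q`-derivatives of monomials -/

/-- The falling factorial `[m]_q [m-1]_q ⋯ [m-j+1]_q`, which is `0` if `m < j`. -/
def qFall (q : ℝ) (m j : ℕ) : ℝ := ∏ i ∈ Finset.range j, (1 - q ^ (m - i)) / (1 - q)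

theorem qFall_zero (q : ℝ) (m : ℕ) : qFall q m 0 = 1 := by simp [qFall]

theorem qFall_succ (q : ℝ) (m j : ℕ) :
    qFall q m (j + 1) = qFall q m j * ((1 - q ^ (m - j)) / (1 - q)) := by
  rw [qFall, Finset.prod_range_succ, ← qFall]

theorem qFall_eq_zero (q : ℝ) {m j : ℕ} (h : m < j) : qFall q m j = 0 :=
  Finset.prod_eq_zero (Finset.mem_range.2 h) (by simp)

theorem qFall_add {q : ℝ} (hq1 : q < 1) (k m : ℕ) :
    qFall q (k + m) m * (1 - q) ^ m * qPoch q q k = qPoch q q (k + m) := by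
  have h1 : (1 - q) ≠ 0 := (sub_pos.2 hq1).ne'
  have h : qFall q (k + m) m * (1 - q) ^ m = qPoch (q * q ^ k) q m := by
    -- Reversing the order of the factors makes the falling product a rising one.
    rw [qFall, Finset.prod_div_distrib, Finset.prod_const, Finset.card_range, div_mul_cancel₀ _
      (pow_ne_zero _ h1), qPoch, ← Finset.prod_range_reflect]
    refine Finset.prod_congr rfl fun i hi => ?_
    have : k + m - (m - 1 - i) = 1 + k + i := by have := Finset.mem_range.1 hi; omega
    rw [this, pow_add, pow_add, pow_one]
  rw [h, qPoch_add, mul_comm]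

theorem qDeriv_sum_pow {q : ℝ} (hq1 : q < 1) (s : Finset ℕ) (a : ℕ → ℝ) (e : ℕ → ℕ) :
    qDeriv q (fun x => ∑ k ∈ s, a k * x ^ e k) =
      fun x => ∑ k ∈ s, a k * ((1 - q ^ e k) / (1 - q)) * x ^ (e k - 1) := by
  have h1 : (1 - q) ≠ 0 := (sub_pos.2 hq1).ne'
  have h2 : (q - 1) ≠ 0 := (sub_neg.2 hq1).ne
  funext x
  unfold qDeriv
  split_ifs with hx
  · subst hx
    have hd : HasDerivAt (fun x : ℝ => ∑ k ∈ s, a k * x ^ e k)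
        (∑ k ∈ s, a k * ((e k : ℝ) * 0 ^ (e k - 1))) 0 :=
      HasDerivAt.fun_sum fun k _ => (hasDerivAt_pow (e k) 0).const_mul (a k)
    rw [hd.deriv]
    refine Finset.sum_congr rfl fun k _ => ?_
    -- At the origin only exponent `1` contributes, where `(1 - q) / (1 - q)` equals the classical
    -- factor `1`.
    rcases e k with _ | _ | m
    · simp
    · simp [div_self h1]
    · simp
  · rw [← Finset.sum_sub_distrib, Finset.sum_div]
    refine Finset.sum_congr rfl fun k _ => ?_
    rcases e k with _ | m
    · simp
    · rw [Nat.add_sub_cancel]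
      field_simp
      ring

theorem iterate_qDeriv_sum_pow {q : ℝ} (hq1 : q < 1) (s : Finset ℕ) (a : ℕ → ℝ) (e : ℕ → ℕ)
    (j : ℕ) :
    (qDeriv q)^[j] (fun x => ∑ k ∈ s, a k * x ^ e k) =
      fun x => ∑ k ∈ s, a k * qFall q (e k) j * x ^ (e k - j) := by
  induction j with
  | zero => simp [qFall_zero]
  | succ j ih =>
    rw [Function.iterate_succ_apply', ih, qDeriv_sum_pow hq1]
    simp only [qFall_succ, Nat.sub_sub, mul_assoc]

/-! ### Gaussian binomials, `q`-Vandermonde and the Sobolev operator -/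

/-- The Gaussian binomial coefficients, defined by the `q`-Pascal rule. -/
def gaussBinom (q : ℝ) : ℕ → ℕ → ℝ
  | _, 0 => 1
  | 0, _ + 1 => 0
  | m + 1, j + 1 => q ^ (j + 1) * gaussBinom q m (j + 1) + gaussBinom q m j

theorem gaussBinom_zero_right (q : ℝ) (m : ℕ) : gaussBinom q m 0 = 1 := by
  cases m <;> rfl

theorem gaussBinom_eq_zero (q : ℝ) {m j : ℕ} (h : m < j) : gaussBinom q m j = 0 := by
  induction m generalizing j with
  | zero => obtain ⟨j, rfl⟩ := Nat.exists_eq_succ_of_ne_zero h.ne'; rfl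
  | succ m ih =>
    obtain ⟨j, rfl⟩ := Nat.exists_eq_succ_of_ne_zero (Nat.ne_zero_of_lt h)
    rw [gaussBinom, ih (by omega), ih (by omega)]
    ring

theorem gaussBinom_mul (q : ℝ) (j l : ℕ) :
    gaussBinom q (j + l) j * (qPoch q q j * qPoch q q l) = qPoch q q (j + l) := by
  induction h : j + l generalizing j l with
  | zero =>
    obtain ⟨rfl, rfl⟩ : j = 0 ∧ l = 0 := by omega
    simp [gaussBinom, qPoch]
  | succ m ih =>
    rcases j with _ | j
    · obtain rfl : l = m + 1 := by omega
      simp [gaussBinom, qPoch_zero]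
    · have e2 := ih j l (by omega)
      have hm : m = j + l := by omega
      have e1 : gaussBinom q m (j + 1) * (qPoch q q (j + 1) * qPoch q q l) =
          qPoch q q m * (1 - q ^ l) := by
        rcases l with _ | l
        · rw [gaussBinom_eq_zero q (by omega)]
          simp
        · rw [qPoch_succ q q l]
          linear_combination (1 - q * q ^ l) * ih (j + 1) l (by omega)
      rw [gaussBinom, qPoch_succ q q m, add_mul, mul_assoc, e1, qPoch_succ, ← e2, hm]
      ring

/-- The `q`-Vandermonde identity for falling factorials. -/
theorem qFall_add_eq_sum (q : ℝ) (k m r : ℕ) :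
    qFall q (k + (m + r)) m = ∑ j ∈ Finset.range (m + 1),
      gaussBinom q m j * q ^ (j * (r + j)) * (qFall q (m + r) (m - j) * qFall q k j) := by
  induction m generalizing r with
  | zero => simp [qFall_zero, gaussBinom]
  | succ m ih =>
    -- The free parameter `r` absorbs the shift, so the upper index `k + (m + 1 + r)` stays fixed in
    -- the induction.
    have hih := ih (r + 1)
    rw [show m + (r + 1) = m + 1 + r by ring] at hih
    rw [qFall_succ, hih, Finset.sum_mul]
    -- The new factor is split as `1 - q^(k+1+r) = (1 - q^(1+r+j)) + q^(1+r+j) (1 - q^(k-j))`; each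
    -- part lengthens one of the two falling factorials. The `q`-Pascal rule then regroups the sums.
    have step : ∀ j ∈ Finset.range (m + 1),
        gaussBinom q m j * q ^ (j * (r + 1 + j)) *
            (qFall q (m + 1 + r) (m - j) * qFall q k j) *
            ((1 - q ^ (k + (m + 1 + r) - m)) / (1 - q)) =
          gaussBinom q m j * q ^ (j * (r + 1 + j)) *
            (qFall q (m + 1 + r) (m + 1 - j) * qFall q k j) +
          gaussBinom q m j * q ^ ((j + 1) * (r + (j + 1))) *
            (qFall q (m + 1 + r) (m + 1 - (j + 1)) * qFall q k (j + 1)) := by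
      intro j hj
      have hjm : j ≤ m := Nat.lt_succ_iff.1 (Finset.mem_range.1 hj)
      rcases lt_or_ge k j with hk | hk
      · simp [qFall_eq_zero q hk, qFall_eq_zero q (hk.trans j.lt_succ_self)]
      · obtain ⟨k, rfl⟩ := Nat.exists_eq_add_of_le hk
        have e1 : m + 1 - j = (m - j) + 1 := by omega
        have e2 : m + 1 + r - (m - j) = 1 + r + j := by omega
        have e3 : j + k + (m + 1 + r) - m = j + k + 1 + r := by omega
        rw [e1, qFall_succ, qFall_succ, e2, e3, Nat.add_sub_cancel_left, Nat.add_sub_add_right]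
        ring
    rw [Finset.sum_congr rfl step, Finset.sum_add_distrib, Finset.sum_range_succ' _ (m + 1)]
    have split : ∀ j, gaussBinom q (m + 1) (j + 1) * q ^ ((j + 1) * (r + (j + 1))) *
        (qFall q (m + 1 + r) (m + 1 - (j + 1)) * qFall q k (j + 1)) =
        gaussBinom q m (j + 1) * q ^ ((j + 1) * (r + 1 + (j + 1))) *
          (qFall q (m + 1 + r) (m + 1 - (j + 1)) * qFall q k (j + 1)) +
        gaussBinom q m j * q ^ ((j + 1) * (r + (j + 1))) *
            (qFall q (m + 1 + r) (m + 1 - (j + 1)) * qFall q k (j + 1)) := by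
      intro j
      rw [gaussBinom]
      ring
    simp only [split, Finset.sum_add_distrib]
    have h0 := Finset.sum_range_succ' (fun j => gaussBinom q m j * q ^ (j * (r + 1 + j)) *
            (qFall q (m + 1 + r) (m + 1 - j) * qFall q k j)) (m + 1)
    rw [Finset.sum_range_succ, gaussBinom_eq_zero q m.lt_succ_self] at h0
    simp only [zero_mul, add_zero, gaussBinom_zero_right, pow_zero] at h0 ⊢
    linear_combination h0

/-- This is `q`-Vandermonde at `r = 0`: the coefficient `d_j` is exactly `gaussBinom q c j * q^(j^2)
* qFall q c (c - j) * z^j`. -/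
theorem sum_sobolevCoeff_mul_qFall {q : ℝ} (hq0 : 0 < q) (hq1 : q < 1) (c k : ℕ) (z : ℝ) :
    ∑ j ∈ Finset.range (c + 1), sobolevCoeff q c j z * (qFall q k j * z ^ (k - j)) =
      qFall q (k + c) c * z ^ k := by
  have hv := qFall_add_eq_sum q k c 0
  rw [add_zero] at hv
  rw [hv, Finset.sum_mul]
  refine Finset.sum_congr rfl fun j hj => ?_
  have hjc : j ≤ c := Nat.lt_succ_iff.1 (Finset.mem_range.1 hj)
  rcases lt_or_ge k j with hk | hk
  · simp [qFall_eq_zero q hk]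
  · obtain ⟨k, rfl⟩ := Nat.exists_eq_add_of_le hk
    obtain ⟨l, rfl⟩ := Nat.exists_eq_add_of_le hjc
    have p1 := (qPoch_pos hq0 hq1 hq1 j).ne'
    have p2 := (qPoch_pos hq0 hq1 hq1 l).ne'
    have p3 : (1 - q) ≠ 0 := (sub_pos.2 hq1).ne'
    have g := gaussBinom_mul q j l
    have f := qFall_add hq1 j l
    have g' : gaussBinom q (j + l) j = qPoch q q (j + l) / (qPoch q q j * qPoch q q l) := by
      rw [← g]; field_simp
    have f' : qFall q (j + l) l = qPoch q q (j + l) / (qPoch q q j * (1 - q) ^ l) := by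
      rw [← f]; field_simp
    rw [sobolevCoeff, Nat.add_sub_cancel_left, Nat.add_sub_cancel_left, g', f', zero_add, pow_add,
      sq j]
    field_simp

theorem sobolevOp_sum_pow {q : ℝ} (hq0 : 0 < q) (hq1 : q < 1) (c : ℕ) (s : Finset ℕ)
    (a : ℕ → ℝ) (z : ℝ) :
    sobolevOp q c (fun x => ∑ k ∈ s, a k * x ^ k) z =
      ∑ k ∈ s, a k * qFall q (k + c) c * z ^ k := by
  have h := fun j => iterate_qDeriv_sum_pow hq1 s a (fun k => k) j
  simp only [sobolevOp, h, Finset.mul_sum]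
  rw [Finset.sum_comm]
  refine Finset.sum_congr rfl fun k _ => ?_
  rw [mul_assoc, ← sum_sobolevCoeff_mul_qFall hq0 hq1, Finset.mul_sum]
  exact Finset.sum_congr rfl fun j _ => by ring

theorem iterate_qDeriv_pow_mul_sum_pow {q : ℝ} (hq1 : q < 1) (c : ℕ) (s : Finset ℕ)
    (a : ℕ → ℝ) (z : ℝ) :
    (qDeriv q)^[c] (fun x => x ^ c * ∑ k ∈ s, a k * x ^ k) z =
      ∑ k ∈ s, a k * qFall q (k + c) c * z ^ k := by
  have h : (fun x : ℝ => x ^ c * ∑ k ∈ s, a k * x ^ k) =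
      fun x => ∑ k ∈ s, a k * x ^ (k + c) := by
    funext x
    rw [Finset.mul_sum]
    exact Finset.sum_congr rfl fun k _ => by ring
  rw [h, iterate_qDeriv_sum_pow hq1]
  simp

/-- Both `(q;q)_c (q^(c+1);q)_k` and `qFall q (k + c) c * (1 - q)^c * (q;q)_k` equal `(q;q)_{k+c}`.
This is the cancellation that makes the Sobolev operator produce `q`-Laguerre polynomials. -/
theorem qFall_mul_qPoch_div {q : ℝ} (hq0 : 0 < q) (hq1 : q < 1) (c k : ℕ) :
    qPoch q q k / qPoch (q ^ (c + 1)) q k * qFall q (k + c) c = qPoch q q c / (1 - q) ^ c := by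
  have h1 := qFall_add hq1 k c
  have h2 := qPoch_add q q c k
  rw [add_comm c k, ← h1, ← pow_succ'] at h2
  have p1 : qPoch (q ^ (c + 1)) q k ≠ 0 :=
    (qPoch_pos hq0 hq1 (pow_lt_one₀ hq0.le hq1 c.succ_ne_zero) k).ne'
  have p3 : (1 - q) ≠ 0 := (sub_pos.2 hq1).ne'
  field_simp
  linear_combination h2

theorem iterate_qDeriv_pow_mul_genQLaguerre {q : ℝ} (hq0 : 0 < q) (hq1 : q < 1) (γ : ℝ)
    (c n : ℕ) (z : ℝ) :
    (qDeriv q)^[c] (fun x => x ^ c * genQLaguerre q γ c n x) z =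
      qPoch q q c / (1 - q) ^ c * qLaguerre q γ n z := by
  simp only [genQLaguerre_eq_sum hq0, qLaguerre_eq_sum hq0]
  rw [iterate_qDeriv_pow_mul_sum_pow hq1, Finset.mul_sum]
  refine Finset.sum_congr rfl fun k _ => ?_
  rw [← qFall_mul_qPoch_div hq0 hq1 c k]
  ring

theorem sobolevOp_genQLaguerre {q : ℝ} (hq0 : 0 < q) (hq1 : q < 1) (γ : ℝ) (c n : ℕ) (z : ℝ) :
    sobolevOp q c (genQLaguerre q γ c n) z = qPoch q q c / (1 - q) ^ c * qLaguerre q γ n z := by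
  rw [← iterate_qDeriv_pow_mul_genQLaguerre hq0 hq1]
  have h : genQLaguerre q γ c n = _ := funext (genQLaguerre_eq_sum hq0 γ c n)
  simp only [h]
  rw [sobolevOp_sum_pow hq0 hq1, iterate_qDeriv_pow_mul_sum_pow hq1]

/-! ### Degree and the second-order `q`-difference equation -/

theorem genQLaguerre_eq_polynomial {q γ : ℝ} (hq0 : 0 < q) (hq1 : q < 1) (hγ : -1 < γ)
    (c n : ℕ) : ∃ P : Polynomial ℝ, P.degree = (n : WithBot ℕ) ∧
      ∀ z : ℝ, genQLaguerre q γ c n z = P.eval z := by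
  have hb1 : q ^ (γ + 1) < 1 := Real.rpow_lt_one hq0.le hq1 (by linarith)
  set a : ℕ → ℝ := fun k => qLaguerreCoeff q (q ^ (γ + 1)) n k *
    (qPoch q q k / qPoch (q ^ (c + 1)) q k) with ha
  refine ⟨∑ k ∈ Finset.range (n + 1), Polynomial.C (a k) * Polynomial.X ^ k, ?_, fun z => ?_⟩
  · have hn : a n ≠ 0 := mul_ne_zero
      (qLaguerreCoeff_ne_zero hq0 hq1 (Real.rpow_pos_of_pos hq0 _) hb1 le_rfl)
      (div_ne_zero (qPoch_pos hq0 hq1 hq1 n).ne'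
        (qPoch_pos hq0 hq1 (pow_lt_one₀ hq0.le hq1 c.succ_ne_zero) n).ne')
    rw [Finset.sum_range_succ, Polynomial.degree_add_eq_right_of_degree_lt,
      Polynomial.degree_C_mul_X_pow n hn]
    rw [Polynomial.degree_C_mul_X_pow n hn]
    refine (Polynomial.degree_sum_le _ _).trans_lt ?_
    refine (Finset.sup_lt_iff (WithBot.bot_lt_coe n)).2 fun k hk => ?_
    exact (Polynomial.degree_C_mul_X_pow_le k _).trans_lt
      (Nat.cast_lt.2 (Finset.mem_range.1 hk))
  · rw [genQLaguerre_eq_sum hq0, Polynomial.eval_finsetSum]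
    simp [ha]

theorem qLaguerreCoeff_succ_mul {q b : ℝ} (hq0 : 0 < q) (hq1 : q < 1) (hb1 : b < 1) (n k : ℕ) :
    qLaguerreCoeff q b n (k + 1) * ((1 - q ^ (k + 1)) * (1 - b * q ^ k)) =
      qLaguerreCoeff q b n k * ((q ^ n - q ^ k) * q ^ k * b) := by
  have h1 := (one_sub_pow_pos hq0 hq1 k).ne'
  have h2 := (qPoch_pos hq0 hq1 hb1 (k + 1)).ne'
  rw [qPoch_succ] at h2
  have h3 := right_ne_zero_of_mul h2
  have h4 := left_ne_zero_of_mul h2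
  rw [qLaguerreCoeff, qLaguerreCoeff, qPochCoeff_succ, qPoch_succ, Nat.choose_succ_succ' k 1,
    Nat.choose_one_right, pow_add q k (k.choose _), pow_succ b]
  generalize 1 - q ^ (k + 1) = u at *
  generalize 1 - b * q ^ k = v at *
  field_simp

/-- The operator maps `z^k` to a combination of `z^(k-1)` and `z^k`. Once the lowering part is
reindexed by the recurrence, the coefficients combine through `(q^n - q^k) - (1 - q^k) = q^n - 1`,
and the remaining `q^k` is the dilation `z ↦ q z`. -/
theorem qLaguerreOp_qLaguerre {q γ : ℝ} (hq0 : 0 < q) (hq1 : q < 1) (hγ : -1 < γ) (C : ℝ)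
    (n : ℕ) (z : ℝ) :
    qLaguerreOp q γ (fun x => C * qLaguerre q γ n x) z =
      qNumber q n / (q - 1) * (C * qLaguerre q γ n (q * z)) := by
  have hb0 : 0 < q ^ (γ + 1) := Real.rpow_pos_of_pos hq0 _
  have hb1 : q ^ (γ + 1) < 1 := Real.rpow_lt_one hq0.le hq1 (by linarith)
  have hf : (fun x => C * qLaguerre q γ n x) = fun x => ∑ k ∈ Finset.range (n + 1),
      (C * qLaguerreCoeff q (q ^ (γ + 1)) n k) * x ^ k := by
    funext x
    rw [qLaguerre_eq_sum hq0, Finset.mul_sum]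
    exact Finset.sum_congr rfl fun k _ => by ring
  have hv : C * qLaguerre q γ n (q * z) = _ := congrFun hf (q * z)
  rw [hv, qLaguerreOp, hf, iterate_qDeriv_sum_pow hq1 _ _ (fun k => k) 2,
    qDeriv_sum_pow hq1 _ _ (fun k => k), qNumber, qNumber, Real.rpow_natCast]
  have hrec := fun k => qLaguerreCoeff_succ_mul hq0 hq1 hb1 n k
  have hzero : qLaguerreCoeff q (q ^ (γ + 1)) n (n + 1) = 0 :=
    qLaguerreCoeff_eq_zero _ _ n.lt_succ_self
  set b := q ^ (γ + 1)
  set a := qLaguerreCoeff q b n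
  have p1 : (1 - q) ≠ 0 := (sub_pos.2 hq1).ne'
  have p2 : (q - 1) ≠ 0 := (sub_neg.2 hq1).ne
  -- the part lowering the degree, written with the recurrence
  let low : ℕ → ℝ := fun k => C * a k * ((1 - q ^ k) * (1 - b * q ^ (k - 1)) /
    (b * (1 - q) ^ 2)) * z ^ (k - 1)
  have hlow : ∀ k, low (k + 1) = C * a k * ((q ^ n - q ^ k) * q ^ k / (1 - q) ^ 2) * z ^ k := by
    intro k
    simp only [low, Nat.add_sub_cancel]
    have := hrec k
    have hl : (1 - q ^ (k + 1)) * (1 - b * q ^ k) / (b * (1 - q) ^ 2) * a (k + 1) =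
        (q ^ n - q ^ k) * q ^ k / (1 - q) ^ 2 * a k := by
      field_simp
      linear_combination this
    linear_combination (C * z ^ k) * hl
  -- The shift loses nothing: `low 0` contains `1 - q^0`, and `low (n + 1)` contains the vanishing
  -- coefficient `a (n + 1)`.
  have hsum : ∑ k ∈ Finset.range (n + 1), low k = ∑ k ∈ Finset.range (n + 1), low (k + 1) := by
    rw [Finset.sum_range_succ', Finset.sum_range_succ]
    simp [low, hzero]
  have hterm : ∀ k, (q * z ^ 2 + z) * (C * a k * qFall q k 2 * z ^ (k - 2)) +
      (q / (q - 1) * z + (b - 1) / (q - 1) / b) *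
        (C * a k * ((1 - q ^ k) / (1 - q)) * z ^ (k - 1)) =
      low k - C * a k * ((1 - q ^ k) * q ^ k / (1 - q) ^ 2) * z ^ k := by
    intro k
    -- For `k = 0, 1` the truncated exponents occur only beside coefficients that are zero.
    rcases k with _ | _ | k
    · simp [low, qFall]
    · simp only [low, qFall, Finset.prod_range_succ, Finset.prod_range_zero]
      norm_num
      field_simp
      ring
    · simp only [low, qFall, Finset.prod_range_succ, Finset.prod_range_zero,
        show k + 1 + 1 - 1 = k + 1 from rfl, show k + 1 + 1 - 2 = k from rfl, Nat.sub_zero]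
      field_simp
      ring
  rw [Finset.mul_sum, Finset.mul_sum, ← Finset.sum_add_distrib,
    Finset.sum_congr rfl fun k _ => hterm k, Finset.sum_sub_distrib, hsum,
    ← Finset.sum_sub_distrib, Finset.mul_sum]
  refine Finset.sum_congr rfl fun k _ => ?_
  rw [hlow, mul_pow]
  field_simp
  ring

/-! ### Infinite products and bounds on the weight -/

theorem summable_mul_pow {q : ℝ} (hq0 : 0 < q) (hq1 : q < 1) (a : ℝ) :
    Summable fun i : ℕ => -(a * q ^ i) :=
  ((summable_geometric_of_lt_one hq0.le hq1).mul_left a).neg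

theorem tendsto_qPoch {q : ℝ} (hq0 : 0 < q) (hq1 : q < 1) (a : ℝ) :
    Tendsto (qPoch a q) atTop (𝓝 (qPochInf a q)) := by
  have h := Real.multipliable_one_add_of_summable (summable_mul_pow hq0 hq1 a)
  simp only [← sub_eq_add_neg] at h
  exact h.tendsto_prod_tprod_nat

theorem qPochInf_eq_mul {q : ℝ} (hq0 : 0 < q) (hq1 : q < 1) (a : ℝ) :
    qPochInf a q = (1 - a) * qPochInf (a * q) q := by
  refine tendsto_nhds_unique ((tendsto_add_atTop_iff_nat 1).2 (tendsto_qPoch hq0 hq1 a)) ?_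
  simp only [qPoch_succ']
  exact (tendsto_qPoch hq0 hq1 _).const_mul _

theorem qPochInf_self_pos {q : ℝ} (hq0 : 0 < q) (hq1 : q < 1) : 0 < qPochInf q q := by
  have h0 : qPochInf q q ≠ 0 := by
    have h := tprod_one_add_ne_zero_of_summable (f := fun i : ℕ => -(q * q ^ i)) (fun i => ?_)
      (summable_mul_pow hq0 hq1 q).norm
    · simp only [← sub_eq_add_neg] at h
      exact h
    · rw [← sub_eq_add_neg, ← pow_succ']
      exact (one_sub_pow_pos hq0 hq1 i).ne'
  exact lt_of_le_of_ne (ge_of_tendsto' (tendsto_qPoch hq0 hq1 q)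
    fun k => (qPoch_pos hq0 hq1 hq1 k).le) h0.symm

theorem one_le_qPoch_neg {q x : ℝ} (hq0 : 0 < q) (hx : 0 ≤ x) (k : ℕ) : 1 ≤ qPoch (-x) q k := by
  induction k with
  | zero => simp [qPoch]
  | succ k ih =>
    rw [qPoch_succ]
    have : 0 ≤ x * q ^ k := by positivity
    nlinarith

theorem monotone_qPoch_neg {q x : ℝ} (hq0 : 0 < q) (hx : 0 ≤ x) : Monotone (qPoch (-x) q) := by
  refine monotone_nat_of_le_succ fun k => ?_
  rw [qPoch_succ]
  have h1 : 0 ≤ x * q ^ k := by positivity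
  have h2 := one_le_qPoch_neg hq0 hx k
  nlinarith

theorem qPoch_neg_le_qPochInf {q x : ℝ} (hq0 : 0 < q) (hq1 : q < 1) (hx : 0 ≤ x) (k : ℕ) :
    qPoch (-x) q k ≤ qPochInf (-x) q :=
  (monotone_qPoch_neg hq0 hx).ge_of_tendsto (tendsto_qPoch hq0 hq1 _) k

theorem one_le_qPochInf_neg {q x : ℝ} (hq0 : 0 < q) (hq1 : q < 1) (hx : 0 ≤ x) :
    1 ≤ qPochInf (-x) q := by
  simpa [qPoch_zero] using qPoch_neg_le_qPochInf hq0 hq1 hx 0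

/-- Dropping the `1` from each factor `1 + x q^i` gives the growth of order `x^k` that controls the
integrals at infinity. -/
theorem pow_mul_le_qPoch_neg {q x : ℝ} (hq0 : 0 < q) (hx : 0 ≤ x) (k : ℕ) :
    x ^ k * ∏ i ∈ Finset.range k, q ^ i ≤ qPoch (-x) q k := by
  rw [← Finset.card_range k, ← Finset.prod_const, Finset.card_range, ← Finset.prod_mul_distrib]
  refine Finset.prod_le_prod (fun i _ => by positivity) fun i _ => ?_
  linarith

theorem measurable_qPoch_neg (q : ℝ) (k : ℕ) : Measurable fun x => qPoch (-x) q k :=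
  Finset.measurable_prod _ fun i _ => by fun_prop

theorem measurable_qPochInf_neg {q : ℝ} (hq0 : 0 < q) (hq1 : q < 1) :
    Measurable fun x => qPochInf (-x) q :=
  measurable_of_tendsto_metrizable (measurable_qPoch_neg q)
    (tendsto_pi_nhds.2 fun x => tendsto_qPoch hq0 hq1 (-x))

/-! ### Mellin transforms and Ramanujan's integral -/

/-- Euler's integral `∫₀^∞ x^(s-1) / (1+x) dx = Γ(s) Γ(1-s)`. -/
theorem integral_rpow_div_one_add {s : ℝ} (hs0 : 0 < s) (hs1 : s < 1) :
    ∫ x in Set.Ioi (0 : ℝ), x ^ (s - 1) / (1 + x) = Real.Gamma s * Real.Gamma (1 - s) := by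
  have hlin : ∀ {a r C : ℝ}, 0 < a → 0 < r → 0 < C →
      ∫⁻ t in Set.Ioi (0 : ℝ), ENNReal.ofReal (C * (t ^ (a - 1) * Real.exp (-(r * t)))) =
        ENNReal.ofReal (C * ((1 / r) ^ a * Real.Gamma a)) := by
    intro a r C ha hr hC
    have hi := Real.integral_rpow_mul_exp_neg_mul_Ioi ha hr
    have hpos : 0 < (1 / r) ^ a * Real.Gamma a :=
      mul_pos (by positivity) (Real.Gamma_pos_of_pos ha)
    -- A nonzero Bochner integral already certifies integrability.
    have hint := Integrable.of_integral_ne_zero (hi ▸ hpos.ne')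
    rw [← hi, ← integral_const_mul, ofReal_integral_eq_lintegral_ofReal (hint.const_mul C)]
    filter_upwards [ae_restrict_mem measurableSet_Ioi] with t ht
    have : 0 < t := ht
    simp only [Pi.zero_apply]
    positivity
  have hpos : 0 < Real.Gamma s * Real.Gamma (1 - s) :=
    mul_pos (Real.Gamma_pos_of_pos hs0) (Real.Gamma_pos_of_pos (by linarith))
  -- Write `1 / (1 + x)` as `∫ exp (-(1 + x) y) dy` and exchange the integrals by Tonelli; both
  -- inner integrals are Gamma integrals.
  have key : ∫⁻ x in Set.Ioi (0 : ℝ), ENNReal.ofReal (x ^ (s - 1) / (1 + x)) =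
      ENNReal.ofReal (Real.Gamma s * Real.Gamma (1 - s)) := by
    calc ∫⁻ x in Set.Ioi (0 : ℝ), ENNReal.ofReal (x ^ (s - 1) / (1 + x))
        = ∫⁻ x in Set.Ioi (0 : ℝ), ∫⁻ y in Set.Ioi (0 : ℝ),
            ENNReal.ofReal (x ^ (s - 1) * Real.exp (-((1 + x) * y))) := by
          refine setLIntegral_congr_fun measurableSet_Ioi fun x hx => ?_
          have hx' : 0 < x := hx
          have h := hlin (a := 1) (r := 1 + x) (C := x ^ (s - 1)) one_pos (by positivity)
            (by positivity)
          simp only [sub_self, Real.rpow_zero, one_mul, Real.rpow_one, Real.Gamma_one,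
            mul_one] at h
          simp only [h, div_eq_mul_inv, one_mul]
      _ = ∫⁻ y in Set.Ioi (0 : ℝ), ∫⁻ x in Set.Ioi (0 : ℝ),
            ENNReal.ofReal (x ^ (s - 1) * Real.exp (-((1 + x) * y))) :=
          lintegral_lintegral_swap (by fun_prop)
      _ = ∫⁻ y in Set.Ioi (0 : ℝ),
            ENNReal.ofReal (Real.Gamma s * (y ^ ((1 - s) - 1) * Real.exp (-(1 * y)))) := by
          refine setLIntegral_congr_fun measurableSet_Ioi fun y hy => ?_
          have hy' : 0 < y := hy
          have h := hlin (a := s) (r := y) (C := Real.exp (-y)) hs0 hy' (Real.exp_pos _)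
          have e1 : ∀ x : ℝ, x ^ (s - 1) * Real.exp (-((1 + x) * y)) =
              Real.exp (-y) * (x ^ (s - 1) * Real.exp (-(y * x))) := by
            intro x
            rw [show -((1 + x) * y) = -y + -(y * x) by ring, Real.exp_add]
            ring
          simp only [e1, h]
          congr 1
          rw [one_div, Real.inv_rpow hy'.le, ← Real.rpow_neg hy'.le, one_mul,
            show 1 - s - 1 = -s by ring]
          ring
      _ = _ := by
          rw [hlin (by linarith) one_pos (Real.Gamma_pos_of_pos hs0)]
          simp
  rw [integral_eq_lintegral_of_nonneg_ae, key, ENNReal.toReal_ofReal hpos.le]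
  · filter_upwards [ae_restrict_mem measurableSet_Ioi] with t ht
    have : 0 < t := ht
    simp only [Pi.zero_apply]
    positivity
  · exact (by fun_prop : Measurable fun x : ℝ => x ^ (s - 1) / (1 + x)).aestronglyMeasurable

theorem integrableOn_rpow_div_qPoch {q s : ℝ} (hq0 : 0 < q) (hs0 : 0 < s) {N : ℕ}
    (hN : s < N) :
    IntegrableOn (fun x : ℝ => x ^ (s - 1) / qPoch (-x) q N) (Set.Ioi 0) := by
  have hmeas : Measurable fun x : ℝ => x ^ (s - 1) / qPoch (-x) q N :=
    (by fun_prop : Measurable fun x : ℝ => x ^ (s - 1)).div (measurable_qPoch_neg q N)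
  rw [← Set.Ioc_union_Ioi_eq_Ioi zero_le_one, integrableOn_union]
  constructor
  · refine Integrable.mono' (intervalIntegral.intervalIntegrable_rpow' (a := 0) (b := 1)
      (r := s - 1) (by linarith)).1 hmeas.aestronglyMeasurable ?_
    filter_upwards [ae_restrict_mem measurableSet_Ioc] with x hx
    have hx0 : 0 < x := hx.1
    have h1 := one_le_qPoch_neg hq0 hx0.le N
    rw [Real.norm_of_nonneg (by positivity)]
    exact div_le_self (by positivity) h1
  · have hC : 0 < ∏ i ∈ Finset.range N, q ^ i := Finset.prod_pos fun i _ => pow_pos hq0 i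
    refine Integrable.mono' ((integrableOn_Ioi_rpow_of_lt (a := s - 1 - N) (c := 1) (by linarith)
      one_pos).mul_const (∏ i ∈ Finset.range N, q ^ i)⁻¹) hmeas.aestronglyMeasurable ?_
    filter_upwards [ae_restrict_mem measurableSet_Ioi] with x hx
    have hx0 : 0 < x := one_pos.trans hx
    have h1 := one_le_qPoch_neg hq0 hx0.le N
    have h2 := pow_mul_le_qPoch_neg hq0 hx0.le N
    rw [Real.norm_of_nonneg (by positivity), Real.rpow_sub hx0 _ (N : ℝ), Real.rpow_natCast,
      ← div_eq_mul_inv, div_div]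
    exact div_le_div_of_nonneg_left (by positivity) (by positivity) h2

theorem integrableOn_rpow_div_qPochInf {q s : ℝ} (hq0 : 0 < q) (hq1 : q < 1) (hs0 : 0 < s) :
    IntegrableOn (fun x : ℝ => x ^ (s - 1) / qPochInf (-x) q) (Set.Ioi 0) := by
  obtain ⟨N, hN⟩ := exists_nat_gt s
  refine Integrable.mono' (integrableOn_rpow_div_qPoch hq0 hs0 hN)
    ((by fun_prop : Measurable fun x : ℝ => x ^ (s - 1)).div
      (measurable_qPochInf_neg hq0 hq1)).aestronglyMeasurable ?_
  filter_upwards [ae_restrict_mem measurableSet_Ioi] with x hx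
  have hx0 : 0 < x := hx
  have h1 := one_le_qPoch_neg hq0 hx0.le N
  have h2 := qPoch_neg_le_qPochInf hq0 hq1 hx0.le N
  have h3 := one_le_qPochInf_neg hq0 hq1 hx0.le
  rw [Real.norm_of_nonneg (by positivity)]
  exact div_le_div_of_nonneg_left (by positivity) (by positivity) h2

/-- The substitution `x ↦ q x` in a Mellin integral. -/
theorem integral_rpow_mul_comp_mul {q : ℝ} (hq0 : 0 < q) (s : ℝ) (f : ℝ → ℝ) :
    ∫ x in Set.Ioi (0 : ℝ), x ^ (s - 1) * f x =
      q ^ s * ∫ x in Set.Ioi (0 : ℝ), x ^ (s - 1) * f (q * x) := by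
  have h := integral_comp_mul_left_Ioi' (fun x : ℝ => x ^ (s - 1) * f x) 0 hq0
  rw [mul_zero] at h
  rw [← h, smul_eq_mul, ← integral_const_mul, ← integral_const_mul]
  refine setIntegral_congr_fun measurableSet_Ioi fun x hx => ?_
  have hx0 : 0 < x := hx
  simp only [Real.mul_rpow hq0.le hx0.le]
  have : q ^ s = q * q ^ (s - 1) := by
    rw [Real.rpow_sub hq0, Real.rpow_one]
    field_simp
  rw [this]
  ring

/-- Let `I` be the integral over `N` factors, and `J`, `K` those over `N + 1` factors with exponents
`s`, `s + 1`. Peeling off the first factor after `x ↦ q x` gives `I = q^s (J + K)`; peeling off the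
last gives `I = J + q^N K`. Eliminating `K` proves the claim; `s < N` makes `K` converge. -/
theorem integral_rpow_div_qPoch_succ {q s : ℝ} (hq0 : 0 < q) (hs0 : 0 < s) {N : ℕ}
    (hN : s < N) :
    (∫ x in Set.Ioi (0 : ℝ), x ^ (s - 1) / qPoch (-x) q (N + 1)) * (1 - q ^ N) =
      (∫ x in Set.Ioi (0 : ℝ), x ^ (s - 1) / qPoch (-x) q N) * (1 - q ^ (N - s)) := by
  have hJ : IntegrableOn (fun x : ℝ => x ^ (s - 1) / qPoch (-x) q (N + 1)) (Set.Ioi 0) :=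
    integrableOn_rpow_div_qPoch hq0 hs0 (by push_cast; linarith)
  have hK : IntegrableOn (fun x : ℝ => x ^ (s + 1 - 1) / qPoch (-x) q (N + 1)) (Set.Ioi 0) :=
    integrableOn_rpow_div_qPoch hq0 (by linarith) (by push_cast; linarith)
  have hrp : ∀ x : ℝ, 0 < x → x ^ (s + 1 - 1) = x ^ (s - 1) * x := by
    intro x hx
    rw [← Real.rpow_add_one hx.ne']
    congr 1
    ring
  have e1 : ∫ x in Set.Ioi (0 : ℝ), x ^ (s - 1) / qPoch (-x) q N =
      q ^ s * ((∫ x in Set.Ioi (0 : ℝ), x ^ (s - 1) / qPoch (-x) q (N + 1)) +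
        ∫ x in Set.Ioi (0 : ℝ), x ^ (s + 1 - 1) / qPoch (-x) q (N + 1)) := by
    have h := integral_rpow_mul_comp_mul hq0 s fun x => (qPoch (-x) q N)⁻¹
    simp only [← div_eq_mul_inv] at h
    rw [h, ← integral_add hJ hK]
    congr 1
    refine setIntegral_congr_fun measurableSet_Ioi fun x hx => ?_
    have hx0 : 0 < x := hx
    have h1 := one_le_qPoch_neg hq0 hx0.le (N + 1)
    have h2 : qPoch (-x) q (N + 1) = (1 + x) * qPoch (-(q * x)) q N := by
      rw [qPoch_succ', sub_neg_eq_add, neg_mul, mul_comm x q]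
    have h3 := one_le_qPoch_neg hq0 (mul_pos hq0 hx0).le N
    simp only [h2, hrp x hx0]
    field_simp
  have e2 : ∫ x in Set.Ioi (0 : ℝ), x ^ (s - 1) / qPoch (-x) q N =
      (∫ x in Set.Ioi (0 : ℝ), x ^ (s - 1) / qPoch (-x) q (N + 1)) +
        q ^ N * ∫ x in Set.Ioi (0 : ℝ), x ^ (s + 1 - 1) / qPoch (-x) q (N + 1) := by
    rw [← integral_const_mul, ← integral_add hJ (hK.const_mul _)]
    refine setIntegral_congr_fun measurableSet_Ioi fun x hx => ?_
    have hx0 : 0 < x := hx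
    have h1 := one_le_qPoch_neg hq0 hx0.le N
    have h2 : 0 < 1 - -x * q ^ N := by
      have : 0 < x * q ^ N := by positivity
      linarith
    simp only [qPoch_succ, hrp x hx0]
    have h3 : x ^ (s - 1) / (qPoch (-x) q N * (1 - -x * q ^ N)) * (1 - -x * q ^ N) =
        x ^ (s - 1) / qPoch (-x) q N := by
      rw [← div_div, div_mul_cancel₀ _ h2.ne']
    rw [← h3]
    ring
  have hq : q ^ ((N : ℝ) - s) * q ^ s = q ^ N := by
    rw [← Real.rpow_add hq0, sub_add_cancel, Real.rpow_natCast]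
  linear_combination q ^ ((N : ℝ) - s) * e1 - e2 +
    ((∫ x in Set.Ioi (0 : ℝ), x ^ (s - 1) / qPoch (-x) q (N + 1)) +
        ∫ x in Set.Ioi (0 : ℝ), x ^ (s + 1 - 1) / qPoch (-x) q (N + 1)) * hq

theorem integral_rpow_div_qPoch {q s : ℝ} (hq0 : 0 < q) (hq1 : q < 1) (hs0 : 0 < s)
    (hs1 : s < 1) (N : ℕ) :
    ∫ x in Set.Ioi (0 : ℝ), x ^ (s - 1) / qPoch (-x) q (N + 1) =
      Real.Gamma s * Real.Gamma (1 - s) * (qPoch (q ^ (1 - s)) q N / qPoch q q N) := by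
  induction N with
  | zero => simpa [qPoch] using integral_rpow_div_one_add hs0 hs1
  | succ N ih =>
    have h := integral_rpow_div_qPoch_succ hq0 hs0 (N := N + 1)
      (hs1.trans_le (by push_cast; linarith [N.cast_nonneg (α := ℝ)]))
    have h1 := (one_sub_pow_pos hq0 hq1 N).ne'
    have h2 := (qPoch_pos hq0 hq1 hq1 N).ne'
    have h3 : q ^ (((N + 1 : ℕ) : ℝ) - s) = q ^ (1 - s) * q ^ N := by
      rw [← Real.rpow_natCast q N, ← Real.rpow_add hq0]
      push_cast
      ring_nf
    rw [ih, h3] at h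
    rw [qPoch_succ, qPoch_succ, ← pow_succ' q N, eq_div_of_mul_eq h1 h]
    generalize 1 - q ^ (N + 1) = u at *
    field_simp

/-- The Mellin transform of `1 / (-x;q)_∞`. -/
def qMoment (q s : ℝ) : ℝ := ∫ x in Set.Ioi (0 : ℝ), x ^ (s - 1) / qPochInf (-x) q

/-- This yields positive norms for every `γ > -1`, including integers, where `gammaProduct` enters
only through its limit. -/
theorem qMoment_pos {q s : ℝ} (hq0 : 0 < q) (hq1 : q < 1) (hs0 : 0 < s) : 0 < qMoment q s := by
  have hpos : ∀ x ∈ Set.Ioi (0 : ℝ), 0 < x ^ (s - 1) / qPochInf (-x) q := fun x hx =>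
    div_pos (Real.rpow_pos_of_pos hx _)
      (one_pos.trans_le (one_le_qPochInf_neg hq0 hq1 (le_of_lt hx)))
  rw [qMoment, setIntegral_pos_iff_support_of_nonneg_ae _
    (integrableOn_rpow_div_qPochInf hq0 hq1 hs0)]
  · rw [Set.inter_eq_right.2 fun x hx => Function.mem_support.2 (hpos x hx).ne']
    simp
  · filter_upwards [ae_restrict_mem measurableSet_Ioi] with x hx
    exact (hpos x hx).le

/-- Substitute `x ↦ q x` and use `(-x;q)_∞ = (1 + x) (-q x;q)_∞`. -/
theorem qMoment_add_one {q s : ℝ} (hq0 : 0 < q) (hq1 : q < 1) (hs0 : 0 < s) :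
    qMoment q (s + 1) = (q ^ (-s) - 1) * qMoment q s := by
  have e1 : qMoment q s = q ^ s * (qMoment q s + qMoment q (s + 1)) := by
    have h := integral_rpow_mul_comp_mul hq0 s fun x => (qPochInf (-x) q)⁻¹
    simp only [← div_eq_mul_inv] at h
    rw [qMoment, qMoment, h, ← h, ← integral_add (integrableOn_rpow_div_qPochInf hq0 hq1 hs0)
      (integrableOn_rpow_div_qPochInf hq0 hq1 (by linarith)), h]
    congr 1
    refine setIntegral_congr_fun measurableSet_Ioi fun x hx => ?_
    have hx0 : 0 < x := hx
    have h2 : qPochInf (-x) q = (1 + x) * qPochInf (-(q * x)) q := by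
      rw [qPochInf_eq_mul hq0 hq1, sub_neg_eq_add, neg_mul, mul_comm x q]
    have h3 := one_le_qPochInf_neg hq0 hq1 (mul_pos hq0 hx0).le
    have h4 : x ^ (s + 1 - 1) = x ^ (s - 1) * x := by
      rw [← Real.rpow_add_one hx0.ne']
      congr 1
      ring
    simp only [h2, h4]
    field_simp
  have hq : q ^ (-s) * q ^ s = 1 := by
    rw [← Real.rpow_add hq0, neg_add_cancel, Real.rpow_zero]
  linear_combination (-q ^ (-s)) * e1 - (qMoment q s + qMoment q (s + 1)) * hq

/-- Let the number of factors tend to infinity; the one-factor integrand `x^(s-1) / (1 + x)`,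
integrable because `s < 1`, dominates. -/
theorem qMoment_mul_of_lt_one {q s : ℝ} (hq0 : 0 < q) (hq1 : q < 1) (hs0 : 0 < s)
    (hs1 : s < 1) : qMoment q s * qPochInf q q = gammaProduct q (s - 1) := by
  have h1 : Tendsto (fun N => ∫ x in Set.Ioi (0 : ℝ), x ^ (s - 1) / qPoch (-x) q (N + 1)) atTop
      (𝓝 (qMoment q s)) := by
    refine tendsto_integral_of_dominated_convergence
      (fun x => x ^ (s - 1) / qPoch (-x) q 1) (fun N => ?_)
      (integrableOn_rpow_div_qPoch hq0 hs0 (by simpa using hs1)) (fun N => ?_) ?_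
    · exact ((by fun_prop : Measurable fun x : ℝ => x ^ (s - 1)).div
        (measurable_qPoch_neg q _)).aestronglyMeasurable
    · filter_upwards [ae_restrict_mem measurableSet_Ioi] with x hx
      have hx0 : 0 < x := hx
      have h1 := one_le_qPoch_neg hq0 hx0.le 1
      have h2 := monotone_qPoch_neg hq0 hx0.le (Nat.le_add_left 1 N)
      have h3 := one_le_qPoch_neg hq0 hx0.le (N + 1)
      rw [Real.norm_of_nonneg (by positivity)]
      exact div_le_div_of_nonneg_left (by positivity) (by positivity) h2
    · filter_upwards [ae_restrict_mem measurableSet_Ioi] with x hx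
      have h3 := one_le_qPochInf_neg hq0 hq1 (le_of_lt hx)
      exact tendsto_const_nhds.div
        ((tendsto_add_atTop_iff_nat 1).2 (tendsto_qPoch hq0 hq1 (-x))) (by positivity)
  have hp := (qPochInf_self_pos hq0 hq1).ne'
  simp only [integral_rpow_div_qPoch hq0 hq1 hs0 hs1] at h1
  have h2 := tendsto_nhds_unique h1 (((tendsto_qPoch hq0 hq1 (q ^ (1 - s))).div
    (tendsto_qPoch hq0 hq1 q) hp).const_mul _)
  rw [h2, gammaProduct, neg_sub, sub_add_cancel]
  field_simp

/-- The same functional equation as for `qMoment` at `s = g + 1`. -/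
theorem gammaProduct_add_one {q g : ℝ} (hq0 : 0 < q) (hq1 : q < 1) (hg : g + 1 ≠ 0) :
    gammaProduct q (g + 1) = (q ^ (-(g + 1)) - 1) * gammaProduct q g := by
  have h1 : Real.Gamma (-g) = -(g + 1) * Real.Gamma (-(g + 1)) := by
    rw [← Real.Gamma_add_one (neg_ne_zero.2 hg)]
    congr 1
    ring
  have h2 : q ^ (-(g + 1)) * q = q ^ (-g) := by
    rw [← Real.rpow_add_one hq0.ne']
    congr 1
    ring
  rw [gammaProduct, gammaProduct, qPochInf_eq_mul hq0 hq1, h2, Real.Gamma_add_one hg, h1]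
  ring

/-- Ramanujan's integral `∫₀^∞ x^γ / (-x;q)_∞ dx`. -/
theorem qMoment_mul_qPochInf {q : ℝ} (hq0 : 0 < q) (hq1 : q < 1) {g : ℝ} (hg : -1 < g)
    (hg' : ∀ k : ℕ, g ≠ k) : qMoment q (g + 1) * qPochInf q q = gammaProduct q g := by
  -- Induction on an integer above `g`: a positive `g` is lowered by `1` until it falls in `(-1,
  -- 0)`.
  obtain ⟨n, hn⟩ := exists_nat_gt g
  induction n generalizing g with
  | zero =>
    rw [qMoment_mul_of_lt_one hq0 hq1 (by linarith) (by simpa using hn), add_sub_cancel_right]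
  | succ n ih =>
    rcases lt_or_gt_of_ne (hg' 0) with h | h
    · rw [Nat.cast_zero] at h
      rw [qMoment_mul_of_lt_one hq0 hq1 (by linarith) (by linarith), add_sub_cancel_right]
    · rw [Nat.cast_zero] at h
      push_cast at hn
      have := ih (g := g - 1) (by linarith)
        (fun k hk => hg' (k + 1) (by push_cast; linarith)) (by linarith)
      have h2 := gammaProduct_add_one hq0 hq1 (g := g - 1) (by linarith)
      rw [sub_add_cancel] at this h2
      rw [qMoment_add_one hq0 hq1 h, h2, ← this]
      ring

/-- For exponents between `s / 2` and `s + 1`, the lower endpoint dominates on `x ≤ 1` and the upper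
one on `x ≥ 1`. -/
theorem continuousAt_qMoment {q s : ℝ} (hq0 : 0 < q) (hq1 : q < 1) (hs0 : 0 < s) :
    ContinuousAt (qMoment q) s := by
  refine continuousAt_of_dominated
    (bound := fun x => x ^ (s / 2 - 1) / qPochInf (-x) q + x ^ (s + 1 - 1) / qPochInf (-x) q)
    ?_ ?_ ((integrableOn_rpow_div_qPochInf hq0 hq1 (by linarith)).add
      (integrableOn_rpow_div_qPochInf hq0 hq1 (by linarith))) ?_
  · exact Eventually.of_forall fun t => ((by fun_prop : Measurable fun x : ℝ => x ^ (t - 1)).div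
      (measurable_qPochInf_neg hq0 hq1)).aestronglyMeasurable
  · filter_upwards [Ioo_mem_nhds (half_lt_self hs0) (lt_add_one s)] with t ht
    filter_upwards [ae_restrict_mem measurableSet_Ioi] with x hx
    have hx0 : 0 < x := hx
    have h3 := one_le_qPochInf_neg hq0 hq1 hx0.le
    rw [Real.norm_of_nonneg (by positivity), ← add_div]
    refine div_le_div_of_nonneg_right ?_ (by positivity)
    rcases le_total x 1 with hx1 | hx1
    · have := Real.rpow_le_rpow_of_exponent_ge hx0 hx1 (sub_le_sub_right ht.1.le 1)
      linarith [Real.rpow_nonneg hx0.le (s + 1 - 1)]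
    · have := Real.rpow_le_rpow_of_exponent_le hx1 (sub_le_sub_right ht.2.le 1)
      linarith [Real.rpow_nonneg hx0.le (s / 2 - 1)]
  · filter_upwards [ae_restrict_mem measurableSet_Ioi] with x hx
    have hx0 : x ≠ 0 := (show 0 < x from hx).ne'
    exact ((Real.continuousAt_const_rpow hx0).comp (f := fun t : ℝ => t - 1)
      (by fun_prop)).div_const _

theorem tendsto_gammaProduct {q γ : ℝ} (hq0 : 0 < q) (hq1 : q < 1) (hγ : -1 < γ) :
    Tendsto (gammaProduct q) (𝓝[≠] γ) (𝓝 (qMoment q (γ + 1) * qPochInf q q)) := by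
  have hc : ContinuousAt (fun g => qMoment q (g + 1) * qPochInf q q) γ :=
    ((continuousAt_qMoment hq0 hq1 (by linarith)).comp (f := fun g : ℝ => g + 1)
      (by fun_prop)).mul_const _
  refine (hc.tendsto.mono_left nhdsWithin_le_nhds).congr' ?_
  -- The naturals other than `γ` form a closed set, so a punctured neighbourhood of `γ` contains no
  -- natural number.
  have hclosed : IsClosed (((↑) : ℕ → ℝ) '' {k | (k : ℝ) ≠ γ}) :=
    Nat.isClosedEmbedding_coe_real.isClosedMap _ (isClosed_discrete _)
  filter_upwards [nhdsWithin_le_nhds (lt_mem_nhds hγ), self_mem_nhdsWithin,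
    nhdsWithin_le_nhds (hclosed.isOpen_compl.mem_nhds (by simp))] with g h1 h2 h3
  refine qMoment_mul_qPochInf hq0 hq1 h1 fun k hk => h3 ⟨k, fun h => h2 (hk.trans h), hk.symm⟩

/-! ### Orthogonality of the `q`-Laguerre polynomials -/

theorem add_choose_two (k j : ℕ) : (k + j).choose 2 = k.choose 2 + j.choose 2 + k * j := by
  induction j with
  | zero => simp
  | succ j ih =>
    rw [← add_assoc, Nat.choose_succ_succ' (k + j) 1, ih, Nat.choose_succ_succ' j 1,
      Nat.choose_one_right, Nat.choose_one_right]
    ring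

theorem qMoment_add_nat {q s : ℝ} (hq0 : 0 < q) (hq1 : q < 1) (hs0 : 0 < s) (k : ℕ) :
    qMoment q (s + k) * ((q ^ s) ^ k * q ^ (k.choose 2)) = qPoch (q ^ s) q k * qMoment q s := by
  induction k with
  | zero => simp [qPoch]
  | succ k ih =>
    have h : q ^ (-(s + k)) * (q ^ s * q ^ k) = 1 := by
      rw [← Real.rpow_natCast q k, ← Real.rpow_add hq0, ← Real.rpow_add hq0, neg_add_cancel,
        Real.rpow_zero]
    rw [Nat.cast_succ, ← add_assoc, qMoment_add_one hq0 hq1 (by positivity),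
      Nat.choose_succ_succ' k 1, Nat.choose_one_right, qPoch_succ, pow_add, pow_succ (q ^ s)]
    linear_combination (1 - q ^ s * q ^ k) * ih +
      qMoment q (s + k) * ((q ^ s) ^ k * q ^ (k.choose 2)) * h

theorem qPoch_eq_zero {q : ℝ} (hq0 : 0 < q) {i j n : ℕ} (hij : i ≤ j) (hn : j < n + i) :
    qPoch ((q ^ j)⁻¹ * q ^ i) q n = 0 := by
  refine Finset.prod_eq_zero (Finset.mem_range.2 (show j - i < n by omega)) ?_
  rw [mul_assoc, ← pow_add, Nat.add_sub_cancel' hij, inv_mul_cancel₀ (pow_ne_zero _ hq0.ne'),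
    sub_self]

/-- Expand `(b q^k;q)_j` in powers of `b` by the `q`-binomial theorem, exchange sums, and resum over
`k` by the same theorem. The coefficient of `b^i` contains `(q^(i-j);q)_n`, which vanishes unless `i
= 0` and `j = n`. -/
theorem sum_qPochCoeff_mul_qPoch {q : ℝ} (hq0 : 0 < q) (hq1 : q < 1) (b : ℝ) {n j : ℕ}
    (hj : j ≤ n) :
    ∑ k ∈ Finset.range (n + 1), qPochCoeff q n k * (((q ^ j)⁻¹) ^ k * qPoch (b * q ^ k) q j) =
      if j = n then qPoch ((q ^ n)⁻¹) q n else 0 := by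
  have h : ∑ k ∈ Finset.range (n + 1),
      qPochCoeff q n k * (((q ^ j)⁻¹) ^ k * qPoch (b * q ^ k) q j) =
      ∑ i ∈ Finset.range (j + 1), qPochCoeff q j i * b ^ i * qPoch ((q ^ j)⁻¹ * q ^ i) q n := by
    simp only [← sum_qPochCoeff_mul_pow hq0 hq1, Finset.mul_sum]
    rw [Finset.sum_comm]
    refine Finset.sum_congr rfl fun i _ => Finset.sum_congr rfl fun k _ => ?_
    rw [mul_pow, mul_pow, ← pow_mul, ← pow_mul q i k, mul_comm k i]
    ring
  rw [h, Finset.sum_range_succ']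
  have h0 : ∀ i ∈ Finset.range j,
      qPochCoeff q j (i + 1) * b ^ (i + 1) * qPoch ((q ^ j)⁻¹ * q ^ (i + 1)) q n = 0 := by
    intro i hi
    rw [qPoch_eq_zero hq0 (Finset.mem_range.1 hi) (by omega), mul_zero]
  rw [Finset.sum_eq_zero h0, zero_add]
  split_ifs with hjn
  · subst hjn
    simp [qPochCoeff]
  · rw [qPoch_eq_zero hq0 j.zero_le (by omega), mul_zero]

/-- This pairs the polynomial with `z^j`. In the moment, `(q^s;q)_{k+j} = (q^s;q)_k (q^(s+k);q)_j`:
the first factor cancels the denominator of the coefficient, and `q^(-k j)` survives from the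
binomial exponents. -/
theorem sum_qLaguerreCoeff_mul_qMoment {q s : ℝ} (hq0 : 0 < q) (hq1 : q < 1) (hs0 : 0 < s)
    {n j : ℕ} (hj : j ≤ n) :
    ∑ k ∈ Finset.range (n + 1), qLaguerreCoeff q (q ^ s) n k * qMoment q (s + (k + j : ℕ)) =
      if j = n then qMoment q s / ((q ^ s) ^ n * q ^ (n.choose 2)) * qPoch ((q ^ n)⁻¹) q n
        else 0 := by
  have hb0 : 0 < q ^ s := Real.rpow_pos_of_pos hq0 _
  have hb1 : q ^ s < 1 := Real.rpow_lt_one hq0.le hq1 hs0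
  have hterm : ∀ k, qLaguerreCoeff q (q ^ s) n k * qMoment q (s + (k + j : ℕ)) =
      qMoment q s / ((q ^ s) ^ j * q ^ (j.choose 2)) *
        (qPochCoeff q n k * (((q ^ j)⁻¹) ^ k * qPoch (q ^ s * q ^ k) q j)) := by
    intro k
    have h1 := qMoment_add_nat hq0 hq1 hs0 (k + j)
    have h2 := (qPoch_pos hq0 hq1 hb1 k).ne'
    rw [qPoch_add, add_choose_two, pow_add, pow_add, pow_add, mul_comm k j, pow_mul] at h1
    rw [qLaguerreCoeff, inv_pow]
    field_simp
    linear_combination qPochCoeff q n k * h1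
  simp only [hterm]
  rw [← Finset.mul_sum, sum_qPochCoeff_mul_qPoch hq0 hq1 _ hj]
  split_ifs with hjn
  · rw [hjn]
  · rw [mul_zero]

theorem qPoch_inv_sq {q : ℝ} (hq0 : 0 < q) (n : ℕ) :
    qPoch ((q ^ n)⁻¹) q n ^ 2 * (q ^ n) ^ n * q ^ n = qPoch q q n ^ 2 := by
  have h := congrArg (· ^ 2) (qPoch_neg_pow_eq hq0 n)
  have he : 2 * (n + 1).choose 2 = n * n + n := by
    have := add_choose_two n n
    induction n with
    | zero => rfl
    | succ n ih =>
      rw [Nat.choose_succ_succ' (n + 1) 1, Nat.choose_one_right, mul_add,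
        ih (congrArg (· ^ 2) (qPoch_neg_pow_eq hq0 n)) (add_choose_two n n)]
      ring
  simp only [mul_pow, ← pow_mul, mul_comm n 2, mul_comm ((n + 1).choose 2) 2, he] at h
  rw [pow_mul (-1 : ℝ), neg_one_sq, one_pow, one_mul, pow_add] at h
  rw [← pow_mul, mul_assoc, h]

/-- Only `j = n` survives, which requires `m = n`; the norm is the leading coefficient times the
pairing with `z^n`. -/
theorem sum_sum_qLaguerreCoeff_mul_qMoment {q s : ℝ} (hq0 : 0 < q) (hq1 : q < 1) (hs0 : 0 < s)
    {n m : ℕ} (hm : m ≤ n) :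
    ∑ k ∈ Finset.range (n + 1), ∑ j ∈ Finset.range (m + 1), qLaguerreCoeff q (q ^ s) n k *
        qLaguerreCoeff q (q ^ s) m j * qMoment q (s + (k + j : ℕ)) =
      if n = m then qPoch q q n / (qPoch (q ^ s) q n * q ^ n) * qMoment q s else 0 := by
  have hb0 : 0 < q ^ s := Real.rpow_pos_of_pos hq0 _
  have hb1 : q ^ s < 1 := Real.rpow_lt_one hq0.le hq1 hs0
  rw [Finset.sum_comm]
  have h : ∀ j ∈ Finset.range (m + 1), ∑ k ∈ Finset.range (n + 1), qLaguerreCoeff q (q ^ s) n k *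
      qLaguerreCoeff q (q ^ s) m j * qMoment q (s + (k + j : ℕ)) =
      if j = n then qLaguerreCoeff q (q ^ s) m n * (qMoment q s /
        ((q ^ s) ^ n * q ^ (n.choose 2)) * qPoch ((q ^ n)⁻¹) q n) else 0 := by
    intro j hj
    have hjn : j ≤ n := (Nat.lt_succ_iff.1 (Finset.mem_range.1 hj)).trans hm
    rw [Finset.sum_congr rfl fun k _ => mul_right_comm _ _ _, ← Finset.sum_mul,
      sum_qLaguerreCoeff_mul_qMoment hq0 hq1 hs0 hjn, mul_comm]
    split_ifs with h
    · rw [h]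
    · rw [mul_zero]
  rw [Finset.sum_congr rfl h, Finset.sum_ite_eq']
  rcases hm.eq_or_lt with rfl | hlt
  · rw [if_pos (by simp), if_pos rfl, qLaguerreCoeff, qPochCoeff_eq hq0, zpow_neg, zpow_natCast]
    have h1 := qPoch_inv_sq hq0 m
    have h2 := (qPoch_pos hq0 hq1 hq1 m).ne'
    have h3 := (qPoch_pos hq0 hq1 hb1 m).ne'
    field_simp
    rw [← h1]
    ring
  · rw [if_neg (by simpa using hlt), if_neg hlt.ne']

theorem sum_mul_sum_mul_weight {q γ z : ℝ} (hz : 0 < z) (s t : Finset ℕ) (a b : ℕ → ℝ) :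
    (∑ k ∈ s, a k * z ^ k) * (∑ j ∈ t, b j * z ^ j) * qLaguerreWeight q γ z =
      ∑ k ∈ s, ∑ j ∈ t, a k * b j * (z ^ (γ + 1 + (k + j : ℕ) - 1) / qPochInf (-z) q) := by
  rw [Finset.sum_mul_sum, Finset.sum_mul]
  refine Finset.sum_congr rfl fun k _ => ?_
  rw [Finset.sum_mul]
  refine Finset.sum_congr rfl fun j _ => ?_
  rw [qLaguerreWeight, show γ + 1 + ((k + j : ℕ) : ℝ) - 1 = γ + ((k + j : ℕ) : ℝ) by ring,
    Real.rpow_add hz, Real.rpow_natCast, pow_add]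
  ring

theorem integrableOn_sum_mul_sum_mul_weight {q γ : ℝ} (hq0 : 0 < q) (hq1 : q < 1) (hγ : -1 < γ)
    (s t : Finset ℕ) (a b : ℕ → ℝ) :
    IntegrableOn (fun z => (∑ k ∈ s, a k * z ^ k) * (∑ j ∈ t, b j * z ^ j) *
      qLaguerreWeight q γ z) (Set.Ici 0) := by
  -- The exponent law for `z^γ` is used at `z > 0`; the origin is a null set.
  rw [integrableOn_Ici_iff_integrableOn_Ioi]
  refine IntegrableOn.congr_fun ?_ (fun z hz => (sum_mul_sum_mul_weight hz s t a b).symm)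
    measurableSet_Ioi
  exact integrable_finsetSum _ fun k _ => integrable_finsetSum _ fun j _ =>
    (integrableOn_rpow_div_qPochInf hq0 hq1 (by
      have : (0 : ℝ) ≤ (k + j : ℕ) := Nat.cast_nonneg _
      linarith)).const_mul _

theorem integral_sum_mul_sum_mul_weight {q γ : ℝ} (hq0 : 0 < q) (hq1 : q < 1) (hγ : -1 < γ)
    (s t : Finset ℕ) (a b : ℕ → ℝ) :
    ∫ z in Set.Ici (0 : ℝ), (∑ k ∈ s, a k * z ^ k) * (∑ j ∈ t, b j * z ^ j) *
        qLaguerreWeight q γ z =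
      ∑ k ∈ s, ∑ j ∈ t, a k * b j * qMoment q (γ + 1 + (k + j : ℕ)) := by
  have hint : ∀ k j : ℕ, IntegrableOn (fun z : ℝ => a k * b j *
      (z ^ (γ + 1 + (k + j : ℕ) - 1) / qPochInf (-z) q)) (Set.Ioi 0) := fun k j =>
    (integrableOn_rpow_div_qPochInf hq0 hq1 (by
      have : (0 : ℝ) ≤ (k + j : ℕ) := Nat.cast_nonneg _
      linarith)).const_mul _
  rw [integral_Ici_eq_integral_Ioi, setIntegral_congr_fun measurableSet_Ioi fun z hz =>
      sum_mul_sum_mul_weight (show 0 < z from hz) s t a b,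
    integral_finsetSum _ fun k _ => integrable_finsetSum _ fun j _ => hint k j]
  refine Finset.sum_congr rfl fun k _ => ?_
  rw [integral_finsetSum _ fun j _ => hint k j]
  exact Finset.sum_congr rfl fun j _ => integral_const_mul _ _

theorem integral_qLaguerre_mul_qLaguerre {q γ : ℝ} (hq0 : 0 < q) (hq1 : q < 1) (hγ : -1 < γ)
    (n m : ℕ) :
    ∫ z in Set.Ici (0 : ℝ), qLaguerre q γ n z * qLaguerre q γ m z * qLaguerreWeight q γ z =
      if n = m then qPoch q q n / (qPoch (q ^ (γ + 1)) q n * q ^ n) * qMoment q (γ + 1)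
        else 0 := by
  wlog hm : m ≤ n generalizing n m
  · simp only [mul_comm (qLaguerre q γ n _)]
    rw [this m n (le_of_not_ge hm), if_neg (by omega), if_neg (by omega)]
  · simp only [qLaguerre_eq_sum hq0]
    rw [integral_sum_mul_sum_mul_weight hq0 hq1 hγ,
      sum_sum_qLaguerreCoeff_mul_qMoment hq0 hq1 (by linarith) hm]

theorem integrableOn_qLaguerre_mul_qLaguerre {q γ : ℝ} (hq0 : 0 < q) (hq1 : q < 1)
    (hγ : -1 < γ) (n m : ℕ) :
    IntegrableOn (fun z => qLaguerre q γ n z * qLaguerre q γ m z * qLaguerreWeight q γ z)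
      (Set.Ici 0) := by
  simp only [qLaguerre_eq_sum hq0]
  exact integrableOn_sum_mul_sum_mul_weight hq0 hq1 hγ _ _ _ _

end

/-! ### Assembly of the main theorem -/

theorem mainTheorem8 (q γ : ℝ) (hq0 : 0 < q) (hq1 : q < 1) (hγ : -1 < γ) (c : ℕ) :
    -- each function is a polynomial of degree `n`
    (∀ n : ℕ, ∃ P : Polynomial ℝ, P.degree = (n : WithBot ℕ) ∧
      ∀ z : ℝ, genQLaguerre q γ c n z = P.eval z) ∧
    -- the two forms of the Sobolev operator, and the relation to the `q`-Laguerre polynomials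
    (∀ (n : ℕ) (z : ℝ),
      sobolevOp q c (genQLaguerre q γ c n) z =
          (qDeriv q)^[c] (fun x => x ^ c * genQLaguerre q γ c n x) z ∧
        (qDeriv q)^[c] (fun x => x ^ c * genQLaguerre q γ c n x) z =
          qPoch q q c / (1 - q) ^ c * qLaguerre q γ n z) ∧
    -- Sobolev-type orthogonality with its norm
    (∃ κ : ℝ, Tendsto (gammaProduct q) (𝓝[≠] γ) (𝓝 κ) ∧
      ((∀ k : ℕ, γ ≠ (k : ℝ)) → κ = gammaProduct q γ) ∧
      (∀ n : ℕ, 0 < sobolevNorm q γ κ c n) ∧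
      ∀ n m : ℕ,
        IntegrableOn (fun z => sobolevOp q c (genQLaguerre q γ c n) z *
          sobolevOp q c (genQLaguerre q γ c m) z * qLaguerreWeight q γ z) (Set.Ici 0) ∧
        ∫ z in Set.Ici (0 : ℝ), sobolevOp q c (genQLaguerre q γ c n) z *
          sobolevOp q c (genQLaguerre q γ c m) z * qLaguerreWeight q γ z =
            if n = m then sobolevNorm q γ κ c n else 0) ∧
    -- the inherited second-order `q`-difference equation
    (∀ (n : ℕ) (z : ℝ),
      qLaguerreOp q γ (sobolevOp q c (genQLaguerre q γ c n)) z =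
        qNumber q n / (q - 1) * sobolevOp q c (genQLaguerre q γ c n) (q * z)) := by
  have hs0 : 0 < γ + 1 := by linarith
  have hb1 : q ^ (γ + 1) < 1 := Real.rpow_lt_one hq0.le hq1 hs0
  have hinf := qPochInf_self_pos hq0 hq1
  have hop : ∀ n, sobolevOp q c (genQLaguerre q γ c n) =
      fun z => qPoch q q c / (1 - q) ^ c * qLaguerre q γ n z :=
    fun n => funext (sobolevOp_genQLaguerre hq0 hq1 γ c n)
  -- Taking `κ` to be the moment times `(q;q)_∞` treats integral and non-integral `γ` uniformly.
  refine ⟨genQLaguerre_eq_polynomial hq0 hq1 hγ c, fun n z => ?_,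
    ⟨qMoment q (γ + 1) * qPochInf q q, tendsto_gammaProduct hq0 hq1 hγ,
      qMoment_mul_qPochInf hq0 hq1 hγ, fun n => ?_, fun n m => ?_⟩, fun n z => ?_⟩
  · rw [iterate_qDeriv_pow_mul_genQLaguerre hq0 hq1, hop]
    exact ⟨rfl, rfl⟩
  · have h1 := qPoch_pos hq0 hq1 hq1 n
    have h2 := qPoch_pos hq0 hq1 hb1 n
    have h3 := qPoch_pos hq0 hq1 hq1 c
    have h4 := qMoment_pos hq0 hq1 hs0
    have h5 : 0 < 1 - q := sub_pos.2 hq1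
    unfold sobolevNorm
    positivity
  · have hfun : ∀ z, sobolevOp q c (genQLaguerre q γ c n) z *
        sobolevOp q c (genQLaguerre q γ c m) z * qLaguerreWeight q γ z =
        (qPoch q q c / (1 - q) ^ c) ^ 2 *
          (qLaguerre q γ n z * qLaguerre q γ m z * qLaguerreWeight q γ z) := by
      intro z
      rw [hop, hop]
      ring
    simp only [hfun]
    refine ⟨(integrableOn_qLaguerre_mul_qLaguerre hq0 hq1 hγ n m).const_mul _, ?_⟩
    rw [integral_const_mul, integral_qLaguerre_mul_qLaguerre hq0 hq1 hγ]
    split_ifs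
    · rw [sobolevNorm, mul_div_cancel_right₀ _ hinf.ne', mul_comm]
    · rw [mul_zero]
  · rw [hop]
    exact qLaguerreOp_qLaguerre hq0 hq1 hγ _ n z
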